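/- Let $M$ be a smooth manifold (Hausdorff, finite-dimensional, without boundary), $\pi:TM\to M$ its tangent bundle, and $A\subset TM\setminus 0$ an open subset with $\pi(A)=M$. An anisotropic linear connection on $A$ is a map assigning to $v\in A$ and smooth vector fields $X,Y$ on $M$ a vector $\nabla^v_XY\in T_{\pi(v)}M$, depending smoothly on $v\in A$ for fixed $X,Y$, which is $C^\infty(M)$-linear in $X$, additive in $Y$, and satisfies $\nabla^v_X(fY)=X(f)Y+f\,\nabla^v_XY$ (evaluated at $\pi(v)$) for $f\in C^\infty(M)$. It is local, so it also acts on locally defined fields, and it is torsion-free if $\nabla^v_XY-\nabla^v_YX=[X,Y]_{\pi(v)}$ for all $v,X,Y$. Its vertical derivative is $$P_v(x,y,z)=\frac{\partial}{\partial t}\nabla^{v+tz}_XY\Big|_{t=0},$$ and its curvature tensor is $$R_v(x,y)z=\Big(\nabla^V_X\nabla^V_YZ-\nabla^V_Y\nabla^V_XZ-\nabla^V_{[X,Y]}Z-P_V(Y,Z,\nabla^V_XV)+P_V(X,Z,\nabla^V_YV)\Big)(\pi(v)),$$ where $v\in A$, $x,y,z\in T_{\pi(v)}M$, where $V,X,Y,Z$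 are smooth vector fields with values $v,x,y,z$ at $\pi(v)$, $V$ having values in $A$ near $\pi(v)$, and where $(\nabla^V_XY)(q):=\nabla^{V(q)}_XY$. A geodesic of $\nabla$ is a smooth curve $\gamma:[a,b]\to M$, $a<b$, with $\dot\gamma(t)\in A$ for all $t$ and $D^{\dot\gamma}_\gamma\dot\gamma=0$, where $D^{v}_\gamma$ is the covariant derivative along $\gamma$ induced by $\nabla$; that is, in coordinates, $\ddot\gamma^k+\dot\gamma^i\dot\gamma^j\,\Gamma^k_{ij}(\dot\gamma)=0$ with $\nabla^v_{\partial_i}\partial_j=\Gamma^k_{ij}(v)\,\partial_k$. The curvature operator of $\nabla$ along a geodesic $\gamma$ is $U\mapsto R_{\dot\gamma}(\dot\gamma,U)\dot\gamma$, for smooth vector fields $U$ along $\gamma$. **Proposition.** Let $\nabla$ be a torsion-free anisotropic linear connection on $A$ such that $$P_v(v,v,u)=0\qquad\text{for all } v\in A,\ u\in T_{\pi(v)}M,$$ and let $\tilde\nabla$ be another torsion-free anisotropic linear connection on $A$ whose difference tensor $\mathfrak L_v(X,Y)=\nabla^v_XY-\tilde\nabla^v_XY$ satisfies $$\mathfrak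 L_v(v,u)=0\qquad\text{for all } v\in A,\ u\in T_{\pi(v)}M.$$ Then $\tilde\nabla$ has the same curvature operator as $\nabla$: the vertical derivative $\tilde P$ of $\tilde\nabla$ also satisfies $\tilde P_v(v,v,u)=0$ for all $v\in A$, $u\in T_{\pi(v)}M$; the connections $\nabla$ and $\tilde\nabla$ have the same geodesics; and for every geodesic $\gamma:[a,b]\to M$, every smooth vector field $U$ along $\gamma$ and every $t\in[a,b]$, $$R_{\dot\gamma}(\dot\gamma,U)\dot\gamma=\tilde R_{\dot\gamma}(\dot\gamma,U)\dot\gamma\quad\text{at } t.$$ -/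

import Mathlib

open Set Filter Bundle
open scoped Manifold ContDiff Topology

noncomputable section

namespace Anisotropic

variable {E : Type*} [NormedAddCommGroup E] [NormedSpace ℝ E]
  {M : Type*} [TopologicalSpace M] [ChartedSpace E M] [IsManifold 𝓘(ℝ, E) ∞ M]

/-- The tangent space `T_p M`. -/
abbrev Tan (E : Type*) [NormedAddCommGroup E] [NormedSpace ℝ E]
    {M : Type*} [TopologicalSpace M] [ChartedSpace E M] (p : M) : Type _ :=
  TangentSpace 𝓘(ℝ, E) p

/-- The total space `TM`. -/
abbrev TanB (E : Type*) [NormedAddCommGroup E] [NormedSpace ℝ E]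
    (M : Type*) [TopologicalSpace M] [ChartedSpace E M] : Type _ :=
  TangentBundle 𝓘(ℝ, E) M

/-- The space `𝔛(M)` of smooth vector fields on `M`. -/
abbrev Field (E : Type*) [NormedAddCommGroup E] [NormedSpace ℝ E]
    (M : Type*) [TopologicalSpace M] [ChartedSpace E M] [IsManifold 𝓘(ℝ, E) ∞ M] : Type _ :=
  ContMDiffSection 𝓘(ℝ, E) E ∞ (fun p : M => TangentSpace 𝓘(ℝ, E) p)

/-- The ring `𝓕(M)` of smooth real functions on `M`. -/
abbrev Fun (E : Type*) [NormedAddCommGroup E] [NormedSpace ℝ E]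
    (M : Type*) [TopologicalSpace M] [ChartedSpace E M] : Type _ :=
  ContMDiffMap 𝓘(ℝ, E) 𝓘(ℝ, ℝ) M ℝ ∞

/-- The vector field `f X`. -/
def fieldSMul (f : Fun E M) (X : Field E M) : Field E M :=
  ⟨fun q => f q • X q, f.contMDiff.smul_section X.contMDiff⟩

/-- The derivative `X(f)(p) = df_p(X(p))` of a smooth function along a vector field. -/
def dirDeriv (X : Field E M) (f : Fun E M) (p : M) : ℝ :=
  NormedSpace.fromTangentSpace (𝕜 := ℝ) (f p) (mfderiv 𝓘(ℝ, E) 𝓘(ℝ, ℝ) f p (X p))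

/-- The standing assumptions on the set of admissible directions: an open subset `A` of the slit
tangent bundle `TM ∖ 0` with `π(A) = M`. -/
structure IsDomain (A : Set (TanB E M)) : Prop where
  isOpen : IsOpen A
  ne_zero : ∀ (p : M) (v : Tan E p), (⟨p, v⟩ : TanB E M) ∈ A → v ≠ 0
  surj : ∀ p : M, ∃ v : Tan E p, (⟨p, v⟩ : TanB E M) ∈ A

/-- An anisotropic linear connection `(v, X, Y) ↦ ∇^v_X Y ∈ T_{π(v)}M` on `A`; `nabla v X Y` is
`∇^v_X Y`. It is additive and satisfies the Leibniz rule in `Y`, is `𝓕(M)`-linear in `X`, and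
`∇_X Y` depends smoothly on `v ∈ A` (it is a smooth `A`-anisotropic vector field). Every axiom
concerns `v ∈ A` only; values off `A` are irrelevant. -/
structure Connection (A : Set (TanB E M)) where
  nabla : ∀ {p : M}, Tan E p → Field E M → Field E M → Tan E p
  add_right : ∀ {p : M} (v : Tan E p), (⟨p, v⟩ : TanB E M) ∈ A → ∀ X Y Y' : Field E M,
    nabla v X (Y + Y') = nabla v X Y + nabla v X Y'
  leibniz : ∀ {p : M} (v : Tan E p), (⟨p, v⟩ : TanB E M) ∈ A →
    ∀ (f : Fun E M) (X Y : Field E M),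
      nabla v X (fieldSMul f Y) = dirDeriv X f p • Y p + f p • nabla v X Y
  add_left : ∀ {p : M} (v : Tan E p), (⟨p, v⟩ : TanB E M) ∈ A → ∀ X X' Y : Field E M,
    nabla v (X + X') Y = nabla v X Y + nabla v X' Y
  smul_left : ∀ {p : M} (v : Tan E p), (⟨p, v⟩ : TanB E M) ∈ A →
    ∀ (f : Fun E M) (X Y : Field E M), nabla v (fieldSMul f X) Y = f p • nabla v X Y
  smooth : ∀ X Y : Field E M, ContMDiffOn 𝓘(ℝ, E).tangent 𝓘(ℝ, E).tangent ∞
    (fun w : TanB E M => (⟨w.proj, nabla w.2 X Y⟩ : TanB E M)) A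

/-- `∇` is torsion-free: `∇^v_X Y - ∇^v_Y X = [X, Y]` for all `v ∈ A`. -/
def Connection.TorsionFree {A : Set (TanB E M)} (D : Connection A) : Prop :=
  ∀ (p : M) (v : Tan E p), (⟨p, v⟩ : TanB E M) ∈ A → ∀ X Y : Field E M,
    D.nabla v X Y - D.nabla v Y X = VectorField.mlieBracket 𝓘(ℝ, E) (⇑X) (⇑Y) p

/-- A global smooth vector field with the same germ at `p` as `σ`. One exists whenever `σ` is
smooth on a neighbourhood of `p`, see `globalize_spec`. -/
def globalize (p : M) (σ : ∀ q : M, Tan E q) : Field E M :=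
  open Classical in
  if h : ∃ Y : Field E M, ∀ᶠ q in 𝓝 p, Y q = σ q then h.choose else 0

/-- A global smooth vector field extending the tangent vector `x`: near `p` its coordinates in the
chart at `p` are constant. -/
def ext {p : M} (x : Tan E p) : Field E M :=
  globalize p (FiberBundle.extend E (E := fun q : M => TangentSpace 𝓘(ℝ, E) q) x)

section Facts

variable [FiniteDimensional ℝ E] [T2Space M]

theorem globalize_spec {p : M} {σ : ∀ q : M, Tan E q} {s : Set M} (hs : s ∈ 𝓝 p)
    (hσ : ContMDiffOn 𝓘(ℝ, E) 𝓘(ℝ, E).tangent ∞ (fun q => (⟨q, σ q⟩ : TanB E M)) s) :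
    ∀ᶠ q in 𝓝 p, globalize p σ q = σ q := by
  have h : ∃ Y : Field E M, ∀ᶠ q in 𝓝 p, Y q = σ q := by
    obtain ⟨u, hus, huo, hpu⟩ := mem_nhds_iff.1 hs
    obtain ⟨f, -, hf⟩ := (SmoothBumpFunction.nhds_basis_tsupport (I := 𝓘(ℝ, E)) p).mem_iff.1
      (huo.mem_nhds hpu)
    refine ⟨⟨fun q => f q • σ q, ?_⟩, ?_⟩
    · exact ContMDiffOn.smul_section_of_tsupport (u := u) f.contMDiff.contMDiffOn huo hf
        (hσ.mono hus)
    · filter_upwards [f.eventuallyEq_one] with q hq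
      change f q • σ q = σ q
      rw [hq]; simp
  unfold globalize
  rw [dif_pos h]
  exact h.choose_spec

theorem ext_spec {p : M} (x : Tan E p) : ∀ᶠ q in 𝓝 p,
    ext x q = FiberBundle.extend E (E := fun q : M => TangentSpace 𝓘(ℝ, E) q) x q := by
  obtain ⟨s, hs, h⟩ := FiberBundle.exists_contMDiffOn_extend (k := ∞) 𝓘(ℝ, E) E
    (V := fun q : M => TangentSpace 𝓘(ℝ, E) q) x
  exact globalize_spec hs h

theorem ext_self {p : M} (x : Tan E p) : ext x p = x := by
  rw [(ext_spec x).self_of_nhds]; simp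

end Facts

namespace Connection

variable {A : Set (TanB E M)} (D : Connection A)

/-- The vertical derivative `P_v(x, y, z) = ∂/∂t (∇^{v+tz}_X Y) |_{t=0}`, where the fields `X`, `Y`
extend `x`, `y`. -/
def vert {p : M} (v x y z : Tan E p) : Tan E p :=
  deriv (fun t : ℝ => D.nabla (v + t • z) (ext x) (ext y)) 0

/-- The derivative `∇^v_x W` at `p` in the direction of a tangent vector `x` of a vector field `W`
that only needs to be defined and smooth near `p`. -/
def der {p : M} (v x : Tan E p) (W : ∀ q : M, Tan E q) : Tan E p :=
  D.nabla v (ext x) (globalize p W)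

/-- `(R^V(X, Y)Z)(p)` with
`R^V(X, Y)Z = ∇^V_X ∇^V_Y Z - ∇^V_Y ∇^V_X Z - ∇^V_{[X, Y]} Z`,
the curvature of the affine connection `∇^V`, for a field `V` that is admissible near `p`. -/
def affineCurv (V X Y Z : Field E M) (p : M) : Tan E p :=
  D.der (V p) (X p) (fun q => D.nabla (V q) Y Z)
    - D.der (V p) (Y p) (fun q => D.nabla (V q) X Z)
    - D.der (V p) (VectorField.mlieBracket 𝓘(ℝ, E) (⇑X) (⇑Y) p) Z

/-- `R^V(X, Y)Z - P_V(Y, Z, ∇^V_X V) + P_V(X, Z, ∇^V_Y V)` at `p`. -/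
def curvOfFields (V X Y Z : Field E M) (p : M) : Tan E p :=
  D.affineCurv V X Y Z p
    - D.vert (V p) (Y p) (Z p) (D.nabla (V p) X V)
    + D.vert (V p) (X p) (Z p) (D.nabla (V p) Y V)

/-- The curvature tensor `R_v(x, y)z`: the preceding expression for fields `V`, `X`, `Y`, `Z`
extending `v`, `x`, `y`, `z`. -/
def curv {p : M} (v x y z : Tan E p) : Tan E p :=
  D.curvOfFields (ext v) (ext x) (ext y) (ext z) p

/-- The difference tensor `𝔏_v(x, y) = ∇^v_X Y - ∇̃^v_X Y`, where `X`, `Y` extend `x`, `y`. -/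
def diff (D D' : Connection A) {p : M} (v x y : Tan E p) : Tan E p :=
  D.nabla v (ext x) (ext y) - D'.nabla v (ext x) (ext y)

end Connection

/-- The velocity `γ̇(t)` of a curve `γ : [a, b] → M` (one-sided at the end points). -/
def velocity (γ : ℝ → M) (a b : ℝ) (t : ℝ) : Tan E (γ t) :=
  mfderivWithin 𝓘(ℝ, ℝ) 𝓘(ℝ, E) γ (Icc a b) t (1 : ℝ)

/-- `U ∈ 𝔛(γ)`: a smooth vector field along the curve `γ : [a, b] → M`. -/
def SmoothAlong (γ : ℝ → M) (a b : ℝ) (U : ∀ t : ℝ, Tan E (γ t)) : Prop :=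
  ContMDiffOn 𝓘(ℝ, ℝ) 𝓘(ℝ, E).tangent ∞ (fun t => (⟨γ t, U t⟩ : TanB E M)) (Icc a b)

namespace Connection

variable {A : Set (TanB E M)} (D : Connection A)

/-- The covariant derivative `D^w_γ X` at time `t`, `w ∈ T_{γ(t)}M`, of a vector field `X` along
`γ : [a, b] → M`. If `X = X^i ∂_i` in the natural frame of the chart at `γ(t)`, then it is
`Ẋ^i(t) ∂_i + X^i(t) ∇^w_{γ̇(t)} ∂_i`; the field `X^i(t) ∂_i` with the coordinates of `X` frozen
at time `t` is `ext (X t)`. -/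
def covAlong (γ : ℝ → M) (a b : ℝ) (t : ℝ) (w : Tan E (γ t)) (X : ∀ s : ℝ, Tan E (γ s)) :
    Tan E (γ t) :=
  (trivializationAt E (fun q : M => TangentSpace 𝓘(ℝ, E) q) (γ t)).symm (γ t)
      (derivWithin (fun s : ℝ =>
        (trivializationAt E (fun q : M => TangentSpace 𝓘(ℝ, E) q) (γ t)
          (⟨γ s, X s⟩ : TanB E M)).2) (Icc a b) t)
    + D.nabla w (ext (velocity (E := E) γ a b t)) (ext (X t))

/-- `γ : [a, b] → M` is a geodesic of `∇`: a smooth curve with `γ̇(t) ∈ A` and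
`D^{γ̇}_γ γ̇ = 0`. -/
structure IsGeodesic (γ : ℝ → M) (a b : ℝ) : Prop where
  smooth : ContMDiffOn 𝓘(ℝ, ℝ) 𝓘(ℝ, E) ∞ γ (Icc a b)
  admissible : ∀ t ∈ Icc a b, (⟨γ t, velocity γ a b t⟩ : TanB E M) ∈ A
  geodesic : ∀ t ∈ Icc a b,
    D.covAlong γ a b t (velocity γ a b t) (fun s => velocity γ a b s) = 0

/-- The curvature operator `R_γ(U) = R_{γ̇}(γ̇, U)γ̇` along a curve `γ : [a, b] → M`. -/
def curvOp (γ : ℝ → M) (a b : ℝ) (U : ∀ t : ℝ, Tan E (γ t)) (t : ℝ) : Tan E (γ t) :=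
  D.curv (velocity γ a b t) (velocity γ a b t) (U t) (velocity γ a b t)

/-- The condition `P_v(v, v, u) = 0` for all `v ∈ A` and `u ∈ T_{π(v)}M`. -/
def VertCond : Prop :=
  ∀ (p : M) (v : Tan E p), (⟨p, v⟩ : TanB E M) ∈ A → ∀ u : Tan E p, D.vert v v v u = 0

end Connection

end Anisotropic

end

namespace Anisotropic

open Module

variable {E : Type*} [NormedAddCommGroup E] [NormedSpace ℝ E]
  {M : Type*} [TopologicalSpace M] [ChartedSpace E M] [IsManifold 𝓘(ℝ, E) ∞ M]

/-! Write `𝔏` for the difference tensor. Both torsions vanish, so `𝔏` is symmetric and `𝔏_v(v, ·) =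
0 = 𝔏_v(·, v)`. Differentiating `𝔏_{v+tz}(x, v+tz) = 0` at `t = 0` gives `P_v(x, v, z) - P̃_v(x, v,
z) = -𝔏_v(x, z)` (`vert_sub_vert`); `x = v` carries the vertical condition over to `∇̃`. The
geodesic equations differ by `𝔏_v(v, v) = 0`. For the curvature (`curv_eq_curv`), extend `v`, `u` to
`V`, `U`. Near the point the connections agree on `∇^V_V` of any field and on `∇^V_U V`. With `w =
∇^V_V V`, the term `-∇^V_U ∇^V_V V` contributes `-𝔏_v(u, w)` to `R - R̃`, and `-P_V(U, V, w)`
contributes `+𝔏_v(u, w)`; nothing else changes. -/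

theorem field_sum_apply {ι : Type*} (s : Finset ι) (S : ι → Field E M) (q : M) :
    (∑ i ∈ s, S i) q = ∑ i ∈ s, S i q := by
  rw [← ContMDiffSection.coeAddHom_apply, map_sum, Finset.sum_apply]
  rfl

/-! ### Tensoriality: from vector fields to their values at a point -/

section Tensoriality

variable [FiniteDimensional ℝ E] [T2Space M]

/-- Near `p` a vector field that vanishes at `p` is a combination of finitely many global fields
with smooth coefficients that vanish at `p`. -/
theorem exists_frame_expansion (p : M) (X : Field E M) (hX : X p = 0) :
    ∃ (f : Fun E M) (g : Fin (finrank ℝ E) → Fun E M) (S : Fin (finrank ℝ E) → Field E M),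
      f p = 1 ∧ (∀ i, g i p = 0) ∧ fieldSMul f (fieldSMul f X) = ∑ i, fieldSMul (g i) (S i) := by
  let e := trivializationAt E (fun q : M => TangentSpace 𝓘(ℝ, E) q) p
  let b := finBasis ℝ E
  have hp : p ∈ e.baseSet := FiberBundle.mem_baseSet_trivializationAt E _ p
  obtain ⟨f, -, hf⟩ := (SmoothBumpFunction.nhds_basis_tsupport (I := 𝓘(ℝ, E)) p).mem_iff.1
    (e.open_baseSet.mem_nhds hp)
  have hX' := contMDiffOn_baseSet_localFrameCoeff (I := 𝓘(ℝ, E)) (e := e) b (k := ∞) (s := ⇑X)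
    X.contMDiff.contMDiffOn
  -- The bump function `f` occurs twice because one factor globalizes the coefficients and the other
  -- the local frame.
  refine ⟨⟨f, f.contMDiff⟩,
    fun i => ⟨fun q => f q • e.localFrameCoeff 𝓘(ℝ, E) b i q (X q), ?_⟩,
    fun i => ⟨fun q => f q • e.localFrame b i q, ?_⟩, f.eq_one, fun i => ?_, ?_⟩
  · have h := hX' i
    refine contMDiff_of_tsupport fun q hq => ?_
    have hq' : q ∈ e.baseSet := hf (tsupport_smul_subset_left _ _ hq)
    exact f.contMDiff.contMDiffAt.smul ((h q hq').contMDiffAt (e.open_baseSet.mem_nhds hq'))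
  · exact ContMDiffOn.smul_section_of_tsupport f.contMDiff.contMDiffOn e.open_baseSet hf
      (e.contMDiffOn_localFrame_baseSet ∞ b i)
  · change f p • e.localFrameCoeff 𝓘(ℝ, E) b i p (X p) = 0
    rw [hX]; simp
  · ext q
    refine Eq.trans ?_ (field_sum_apply _ _ q).symm
    change f q • f q • X q = ∑ i, (f q • e.localFrameCoeff 𝓘(ℝ, E) b i q (X q)) •
      f q • e.localFrame b i q
    by_cases hq : q ∈ e.baseSet
    · conv_lhs => rw [e.eq_sum_localFrameCoeff_smul (I := 𝓘(ℝ, E)) (b := b) hq (s := ⇑X)]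
      simp only [Finset.smul_sum, smul_smul]
      refine Finset.sum_congr rfl fun i _ => ?_
      congr 1
      simp only [smul_eq_mul]; ring
    · have : f q = 0 := by
        by_contra h
        exact hq (hf (subset_tsupport _ h))
      simp [this]

/-- A map on vector fields that is additive and `𝓕(M)`-linear at `p` depends on the value at `p`
only. -/
theorem tensorial_congr {W : Type*} [AddCommGroup W] [Module ℝ W] {p : M} {Φ : Field E M → W}
    (hadd : ∀ X Y, Φ (X + Y) = Φ X + Φ Y) (hsmul : ∀ (f : Fun E M) X, Φ (fieldSMul f X) = f p • Φ X)
    {X Y : Field E M} (h : X p = Y p) : Φ X = Φ Y := by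
  obtain ⟨f, g, S, hf, hg, hfg⟩ := exists_frame_expansion p (X - Y)
    (by rw [ContMDiffSection.coe_sub, Pi.sub_apply, h, sub_self])
  let Ψ : Field E M →+ W := AddMonoidHom.mk' Φ hadd
  have h0 : Φ (X - Y) = 0 := by
    have h1 : Φ (fieldSMul f (fieldSMul f (X - Y))) = 0 := by
      rw [hfg]
      change Ψ _ = 0
      rw [map_sum]
      refine Finset.sum_eq_zero fun i _ => ?_
      change Φ _ = 0
      rw [hsmul, hg, zero_smul]
    simpa [hsmul, hf] using h1
  have h2 : Ψ (X - Y) = 0 := h0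
  rw [map_sub, sub_eq_zero] at h2
  exact h2

end Tensoriality

/-- Equal germs define the same predicate on fields, so the choice in `globalize` returns the same
field, equal everywhere and not just near `p`. -/
theorem globalize_congr {p : M} {σ τ : ∀ q : M, Tan E q} (h : ∀ᶠ q in 𝓝 p, σ q = τ q) :
    globalize p σ = globalize p τ := by
  have : (fun Y : Field E M => ∀ᶠ q in 𝓝 p, Y q = σ q) = fun Y => ∀ᶠ q in 𝓝 p, Y q = τ q := by
    funext Y
    refine propext ⟨fun h' => ?_, fun h' => ?_⟩
    · filter_upwards [h, h'] with q h1 h2 using h2.trans h1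
    · filter_upwards [h, h'] with q h1 h2 using h2.trans h1.symm
  exact congrArg (fun P : Field E M → Prop =>
    open Classical in if h : ∃ Y, P Y then h.choose else 0) this

theorem hasDerivAt_neg_smul_zero {g : ℝ → E} (hg : DifferentiableAt ℝ g 0) :
    HasDerivAt (fun t => -(t • g t)) (-g 0) 0 := by
  simpa using ((hasDerivAt_id' (0 : ℝ)).fun_smul hg.hasDerivAt).fun_neg

theorem contMDiff_fiber_line {p : M} (v z : Tan E p) :
    ContMDiff 𝓘(ℝ, ℝ) 𝓘(ℝ, E).tangent ∞ (fun t : ℝ => (⟨p, v + t • z⟩ : TanB E M)) := by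
  intro t
  rw [contMDiffAt_totalSpace]
  refine ⟨contMDiffAt_const, ?_⟩
  let e := trivializationAt E (fun q : M => TangentSpace 𝓘(ℝ, E) q) p
  let L := e.continuousLinearMapAt ℝ p
  have hL : ∀ t : ℝ, (e ⟨p, v + t • z⟩).2 = L v + t • L z := fun t => by
    rw [← map_smul, ← map_add]
    exact (e.continuousLinearMapAt_apply_of_mem ℝ
      (FiberBundle.mem_baseSet_trivializationAt E _ p) _).symm
  have h : ContDiff ℝ ∞ fun t : ℝ => L v + t • L z := by fun_prop
  exact (h.contMDiff t).congr_of_eventuallyEq (Eventually.of_forall hL)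

theorem eventually_mem_line {A : Set (TanB E M)} (hA : IsOpen A) {p : M} {v : Tan E p}
    (hv : (⟨p, v⟩ : TanB E M) ∈ A) (z : Tan E p) :
    ∀ᶠ t in 𝓝 (0 : ℝ), (⟨p, v + t • z⟩ : TanB E M) ∈ A := by
  refine (contMDiff_fiber_line v z).continuous.continuousAt.eventually_mem (hA.mem_nhds ?_)
  simpa using hv

namespace Connection

variable {A : Set (TanB E M)}

/-- The curve stays in one fibre: it is smooth in the trivialization at `p`, and a fixed continuous
linear map brings it back to `T_pM`. -/
theorem differentiableAt_nabla_line (D : Connection A) (hA : IsOpen A) {p : M} {v : Tan E p}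
    (hv : (⟨p, v⟩ : TanB E M) ∈ A) (z : Tan E p) (X Y : Field E M) :
    DifferentiableAt ℝ (F := E) (fun t : ℝ => D.nabla (v + t • z) X Y) 0 := by
  have hv' : (⟨p, v + (0 : ℝ) • z⟩ : TanB E M) ∈ A := by simpa using hv
  have h1 := ((D.smooth X Y).contMDiffAt (hA.mem_nhds hv')).comp (0 : ℝ)
    (contMDiff_fiber_line v z 0)
  have h2 := (contMDiffAt_totalSpace.1 h1).2.contDiffAt.differentiableAt (by simp)
  let e := trivializationAt E (fun q : M => TangentSpace 𝓘(ℝ, E) q) p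
  let L : E →L[ℝ] E := e.symmL ℝ p
  refine (L.differentiableAt.comp 0 h2).congr_of_eventuallyEq (Eventually.of_forall fun t => ?_)
  have hp : p ∈ e.baseSet := FiberBundle.mem_baseSet_trivializationAt E _ p
  exact ((e.symmL_apply hp _).trans
    (e.symm_apply_apply_mk hp (D.nabla (v + t • z) X Y))).symm

theorem contMDiffOn_nabla (D : Connection A) (V X Y : Field E M) :
    ContMDiffOn 𝓘(ℝ, E) 𝓘(ℝ, E).tangent ∞
      (fun q => (⟨q, D.nabla (V q) X Y⟩ : TanB E M)) {q | (⟨q, V q⟩ : TanB E M) ∈ A} :=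
  (D.smooth X Y).comp V.contMDiff.contMDiffOn fun _ hq => hq

variable (D D' : Connection A)

theorem diff_comm (hD : D.TorsionFree) (hD' : D'.TorsionFree) {p : M} {v : Tan E p}
    (hv : (⟨p, v⟩ : TanB E M) ∈ A) (x y : Tan E p) : diff D D' v x y = diff D D' v y x := by
  have h := (hD p v hv (ext x) (ext y)).trans (hD' p v hv (ext x) (ext y)).symm
  rw [diff, diff, sub_eq_sub_iff_sub_eq_sub]
  exact h

/-! ### The difference tensor, vertical derivatives and curvature -/

section Diff

variable [FiniteDimensional ℝ E] [T2Space M]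

/-- The difference `∇ - ∇̃` is tensorial in both arguments. -/
theorem nabla_sub_nabla {p : M} {v : Tan E p} (hv : (⟨p, v⟩ : TanB E M) ∈ A) (X Y : Field E M) :
    D.nabla v X Y - D'.nabla v X Y = diff D D' v (X p) (Y p) := by
  have hX : ∀ Y X X' : Field E M, X p = X' p →
      D.nabla v X Y - D'.nabla v X Y = D.nabla v X' Y - D'.nabla v X' Y := fun Y X X' h =>
    tensorial_congr (Φ := fun X => D.nabla v X Y - D'.nabla v X Y)
      (fun X X' => by simp only [add_left _ v hv]; abel)
      (fun f X => by simp only [smul_left _ v hv, smul_sub]) h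
  have hY : ∀ X Y Y' : Field E M, Y p = Y' p →
      D.nabla v X Y - D'.nabla v X Y = D.nabla v X Y' - D'.nabla v X Y' := fun X Y Y' h =>
    tensorial_congr (Φ := fun Y => D.nabla v X Y - D'.nabla v X Y)
      (fun X X' => by simp only [add_right _ v hv]; abel)
      -- The derivative terms of the two Leibniz rules are identical and cancel.
      (fun f X => by simp only [leibniz _ v hv, smul_sub]; abel) h
  rw [diff, hX Y X (ext (X p)) (ext_self _).symm, hY _ Y (ext (Y p)) (ext_self _).symm]

theorem diff_add_right {p : M} {v : Tan E p} (hv : (⟨p, v⟩ : TanB E M) ∈ A) (x y y' : Tan E p) :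
    diff D D' v x (y + y') = diff D D' v x y + diff D D' v x y' := by
  have h := nabla_sub_nabla D D' hv (ext x) (ext y + ext y')
  rw [ContMDiffSection.coe_add, Pi.add_apply, ext_self, ext_self, ext_self] at h
  rw [← h, add_right _ v hv, add_right _ v hv, diff, diff]
  abel

theorem diff_smul_right {p : M} {v : Tan E p} (hv : (⟨p, v⟩ : TanB E M) ∈ A) (c : ℝ)
    (x y : Tan E p) : diff D D' v x (c • y) = c • diff D D' v x y := by
  -- `ext (c • y)` need not be `c` times `ext y`; tensoriality allows the replacement, as both have
  -- value `c • y` at `p`.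
  let X : Field E M := fieldSMul (ContMDiffMap.const c) (ext y)
  have h1 := tensorial_congr (p := p) (Φ := fun Y => D.nabla v (ext x) Y - D'.nabla v (ext x) Y)
    (fun X X' => by simp only [add_right _ v hv]; abel)
    (fun f X => by simp only [leibniz _ v hv, smul_sub]; abel) (X := ext (c • y)) (Y := X) (by
      change _ = c • (ext y) p
      rw [ext_self, ext_self])
  simp only [X, leibniz _ v hv] at h1
  rw [diff, h1, diff]
  change _ + c • _ - (_ + c • _) = _
  rw [smul_sub]; abel

variable {D D'}

/-- If `𝔏_v(·, v) = 0` on `A`, then `P_v(x, v, z) - P̃_v(x, v, z) = -𝔏_v(x, z)`. -/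
theorem vert_sub_vert (hA : IsOpen A)
    (hL : ∀ (p : M) (v : Tan E p), (⟨p, v⟩ : TanB E M) ∈ A → ∀ x, diff D D' v x v = 0)
    {p : M} {v : Tan E p} (hv : (⟨p, v⟩ : TanB E M) ∈ A) (x z : Tan E p) :
    D.vert v x v z - D'.vert v x v z = -diff D D' v x z := by
  have hd : ∀ y : Tan E p,
      DifferentiableAt ℝ (F := E) (fun t : ℝ => diff D D' (v + t • z) x y) 0 := fun y =>
    (D.differentiableAt_nabla_line hA hv z (ext x) (ext y)).sub
      (D'.differentiableAt_nabla_line hA hv z (ext x) (ext y))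
  have h1 : D.vert v x v z - D'.vert v x v z
      = deriv (F := E) (fun t : ℝ => diff D D' (v + t • z) x v) 0 :=
    (deriv_fun_sub (F := E) (D.differentiableAt_nabla_line hA hv z (ext x) (ext v))
      (D'.differentiableAt_nabla_line hA hv z (ext x) (ext v))).symm
  -- Expand `𝔏_{v+tz}(x, v+tz) = 0` in its last slot. The factor `t` makes the derivative at `0`
  -- independent of that of `𝔏_{v+tz}(x, z)`.
  have h2 : (fun t : ℝ => (diff D D' (v + t • z) x v : E)) =ᶠ[𝓝 0]
      fun t : ℝ => -(t • (diff D D' (v + t • z) x z : E)) := by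
    filter_upwards [eventually_mem_line hA hv z] with t ht
    have h := hL p _ ht x
    rw [diff_add_right D D' ht, diff_smul_right D D' ht] at h
    exact eq_neg_of_add_eq_zero_left h
  have h3 := hasDerivAt_neg_smul_zero (hd z)
  have h4 : diff D D' (v + (0 : ℝ) • z) x z = diff D D' v x z := by rw [zero_smul, add_zero]
  rw [← h4]
  exact h1.trans ((Filter.EventuallyEq.deriv_eq (F := E) h2).trans h3.deriv)

/-- Under the hypothesis `𝔏_v(v, ·) = 0`, the tensors `R_v(v, ·)v` of two torsion-free connections
agree. -/
theorem curv_eq_curv (hA : IsOpen A) (hD : D.TorsionFree) (hD' : D'.TorsionFree)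
    (hL : ∀ (p : M) (v : Tan E p), (⟨p, v⟩ : TanB E M) ∈ A → ∀ x, diff D D' v v x = 0)
    {p : M} {v : Tan E p} (hv : (⟨p, v⟩ : TanB E M) ∈ A) (u : Tan E p) :
    D.curv v v u v = D'.curv v v u v := by
  have hL' : ∀ (p : M) (v : Tan E p), (⟨p, v⟩ : TanB E M) ∈ A → ∀ x, diff D D' v x v = 0 :=
    fun p v hv x => (diff_comm D D' hD hD' hv x v).trans (hL p v hv x)
  set V : Field E M := ext v
  set U : Field E M := ext u
  have hVp : V p = v := ext_self v
  have hs : {q | (⟨q, V q⟩ : TanB E M) ∈ A} ∈ 𝓝 p :=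
    V.contMDiff.continuous.continuousAt.eventually_mem (hA.mem_nhds (by
      change (⟨p, V p⟩ : TanB E M) ∈ A
      rwa [hVp]))
  have hUV : ∀ q, (⟨q, V q⟩ : TanB E M) ∈ A → D.nabla (V q) U V = D'.nabla (V q) U V :=
    fun q hq => sub_eq_zero.1 ((nabla_sub_nabla D D' hq U V).trans (hL' q _ hq _))
  have hVX : ∀ (X : Field E M) q, (⟨q, V q⟩ : TanB E M) ∈ A →
      D.nabla (V q) V X = D'.nabla (V q) V X :=
    fun X q hq => sub_eq_zero.1 ((nabla_sub_nabla D D' hq V X).trans (hL q _ hq _))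
  have hvA : (⟨p, V p⟩ : TanB E M) ∈ A := by rwa [hVp]
  set w := D.nabla (V p) V V with hw
  have e1 : D.der (V p) (V p) (fun q => D.nabla (V q) U V)
      = D'.der (V p) (V p) (fun q => D'.nabla (V q) U V) := by
    have hg := globalize_congr (p := p) (σ := fun q => D.nabla (V q) U V)
      (τ := fun q => D'.nabla (V q) U V) (by filter_upwards [hs] with q hq using hUV q hq)
    rw [der, der, ← hg, ← sub_eq_zero, nabla_sub_nabla D D' hvA, ext_self (V p)]
    exact hL _ _ hvA _
  -- The inner fields have the same germ; the outer derivative along `U` leaves the one discrepancy,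
  -- which `e4` cancels.
  have e2 : D.der (V p) (U p) (fun q => D.nabla (V q) V V)
      - D'.der (V p) (U p) (fun q => D'.nabla (V q) V V) = diff D D' (V p) (U p) w := by
    have hg := globalize_congr (p := p) (σ := fun q => D.nabla (V q) V V)
      (τ := fun q => D'.nabla (V q) V V) (by filter_upwards [hs] with q hq using hVX V q hq)
    rw [der, der, ← hg, nabla_sub_nabla D D' hvA, ext_self (U p),
      (globalize_spec hs (D.contMDiffOn_nabla V V V)).self_of_nhds]
  have e3 : ∀ x, D.der (V p) x V = D'.der (V p) x V := fun x => by
    rw [der, der, ← sub_eq_zero, nabla_sub_nabla D D' hvA,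
      (globalize_spec univ_mem V.contMDiff.contMDiffOn).self_of_nhds]
    exact hL' _ _ hvA _
  have e4 := vert_sub_vert hA hL' hvA (U p) w
  have e5 := vert_sub_vert hA hL' hvA (V p) (D.nabla (V p) U V)
  rw [hL _ _ hvA, neg_zero, sub_eq_zero] at e5
  change D.curvOfFields V V U V p = D'.curvOfFields V V U V p
  rw [curvOfFields, curvOfFields, affineCurv, affineCurv, ← hVX V p hvA, ← hUV p hvA, ← hw,
    e1, e3, e5, eq_add_of_sub_eq e2, eq_add_of_sub_eq e4]
  abel

end Diff

variable {D D'}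

/-- The coordinate derivative in `covAlong` does not involve the connection, so only `𝔏_v(v, v)` at
the velocity matters. -/
theorem IsGeodesic.congr (h : ∀ (p : M) (v : Tan E p), (⟨p, v⟩ : TanB E M) ∈ A →
    diff D D' v v v = 0) {γ : ℝ → M} {a b : ℝ} (hγ : D.IsGeodesic γ a b) :
    D'.IsGeodesic γ a b := by
  refine ⟨hγ.smooth, hγ.admissible, fun t ht => ?_⟩
  rw [← hγ.geodesic t ht, covAlong, covAlong, sub_eq_zero.1 (h _ _ (hγ.admissible t ht))]

end Connection

end Anisotropic

theorem proposition2p21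
    {E : Type*} [NormedAddCommGroup E] [NormedSpace ℝ E] [FiniteDimensional ℝ E]
    {M : Type*} [TopologicalSpace M] [T2Space M] [ChartedSpace E M] [IsManifold 𝓘(ℝ, E) ∞ M]
    (A : Set (Anisotropic.TanB E M)) (hA : Anisotropic.IsDomain A)
    (D D' : Anisotropic.Connection A)
    (hD : D.TorsionFree) (hD' : D'.TorsionFree)
    (hP : D.VertCond)
    (hL : ∀ (p : M) (v : Anisotropic.Tan E p), (⟨p, v⟩ : Anisotropic.TanB E M) ∈ A →
      ∀ u : Anisotropic.Tan E p, Anisotropic.Connection.diff D D' v v u = 0) :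
    D'.VertCond ∧
    ∀ (a b : ℝ), a < b → ∀ γ : ℝ → M,
      (D.IsGeodesic γ a b ↔ D'.IsGeodesic γ a b) ∧
      (D.IsGeodesic γ a b →
        ∀ U : ∀ t : ℝ, Anisotropic.Tan E (γ t), Anisotropic.SmoothAlong γ a b U →
          ∀ t ∈ Icc a b, D.curvOp γ a b U t = D'.curvOp γ a b U t) := by
  have hL' : ∀ (p : M) (v : Anisotropic.Tan E p), (⟨p, v⟩ : Anisotropic.TanB E M) ∈ A →
      ∀ u : Anisotropic.Tan E p, Anisotropic.Connection.diff D D' v u v = 0 :=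
    fun p v hv u => (Anisotropic.Connection.diff_comm D D' hD hD' hv u v).trans (hL p v hv u)
  refine ⟨fun p v hv u => ?_, fun a b _ γ => ⟨⟨fun h => ?_, fun h => ?_⟩, fun h U _ t ht => ?_⟩⟩
  · have h := Anisotropic.Connection.vert_sub_vert hA.isOpen hL' hv v u
    rwa [hP p v hv, hL p v hv, neg_zero, zero_sub, neg_eq_zero] at h
  · exact h.congr fun p v hv => hL p v hv v
  · refine h.congr fun p v hv => ?_
    rw [Anisotropic.Connection.diff, sub_eq_zero.1 (hL p v hv v), sub_self]
  · exact Anisotropic.Connection.curv_eq_curv hA.isOpen hD hD' hL (h.admissible t ht) (U t)
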